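/- Let $G$ be a finite abelian group, written additively. The Davenport constant $D(G)$ is the least integer $n$ such that every sequence of $n$ elements of $G$ has a non-empty subsequence with sum $0$. Let $M$ be a matroid on a finite ground set $E$ and let $\ell : E \to G$ be a labeling. For $g \in G$, a $g$-base is a base $B$ of $M$ with $\sum_{e \in B} \ell(e) = g$. For a weight function $w : E \to \mathbb{R}$, an optimum base is a base $B$ minimizing $w(B) = \sum_{e\in B} w(e)$ among all bases, and an optimum $g$-base is a $g$-base minimizing $w(B)$ among all $g$-bases. The labeling $\ell$ is strongly $k$-close if for every $w : E \to \mathbb{R}$ and every $g \in G$ for which a $g$-base exists, every optimum base $A$ has an optimum $g$-base $B$ with $|A \setminus B| \le k$. The group $G$ is strongly $k$-close if every $G$-labeling of every matroid with finite ground set is strongly $k$-close. Proposition. Every finite abelian group $G$ with $|G| \le 4$ is strongly $(D(G)-1)$-close. -/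

import Mathlib

universe u v

namespace GroupLabeled

/-- The Davenport constant `D(G)`: the least `n` such that every sequence of `n` elements of `G`
has a non-empty subsequence with sum `0`. -/
noncomputable def davenport (G : Type*) [AddCommGroup G] : ℕ :=
  sInf {n : ℕ | ∀ x : Fin n → G, ∃ S : Finset (Fin n), S.Nonempty ∧ ∑ i ∈ S, x i = 0}

section Labeling

variable {α G : Type*} [AddCommGroup G]

/-- `B` is a `g`-base of `M`: a base with label sum `g`. Bases are taken as `Finset`s; in a matroid
with finite ground set every base is of this form. -/
def IsLabelBase (M : Matroid α) (ℓ : α → G) (g : G) (B : Finset α) : Prop :=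
  M.IsBase (B : Set α) ∧ ∑ e ∈ B, ℓ e = g

/-- `A` is an optimum base: a base of minimum weight. -/
def IsOptBase (M : Matroid α) (w : α → ℝ) (A : Finset α) : Prop :=
  M.IsBase (A : Set α) ∧ ∀ A' : Finset α, M.IsBase (A' : Set α) → ∑ e ∈ A, w e ≤ ∑ e ∈ A', w e

/-- `B` is an optimum `g`-base: a `g`-base of minimum weight among all `g`-bases. -/
def IsOptLabelBase (M : Matroid α) (ℓ : α → G) (w : α → ℝ) (g : G) (B : Finset α) : Prop :=
  IsLabelBase M ℓ g B ∧ ∀ B' : Finset α, IsLabelBase M ℓ g B' → ∑ e ∈ B, w e ≤ ∑ e ∈ B', w e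

/-- The labeling `ℓ` of the matroid `M` is strongly `k`-close. -/
def IsStronglyCloseLabeling (M : Matroid α) (ℓ : α → G) (k : ℕ) : Prop :=
  ∀ (w : α → ℝ) (g : G), (∃ B, IsLabelBase M ℓ g B) →
    ∀ A, IsOptBase M w A →
      ∃ B, IsOptLabelBase M ℓ w g B ∧ ((A : Set α) \ (B : Set α)).ncard ≤ k

end Labeling

/-- The group `G` is strongly `k`-close: every `G`-labeling of every matroid (with finite ground set)
is strongly `k`-close. -/
def IsStronglyClose (G : Type u) [AddCommGroup G] (k : ℕ) : Prop :=
  ∀ (α : Type v) (M : Matroid α), M.Finite → ∀ ℓ : α → G, IsStronglyCloseLabeling M ℓ k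

end GroupLabeled

namespace GroupLabeled

section Exchange

variable {α : Type*} [DecidableEq α] {M : Matroid α} {A B : Finset α}

/-- Symmetric exchange between two bases. -/
theorem exists_symmetric_exchange (hA : M.IsBase (A : Set α)) (hB : M.IsBase (B : Set α))
    {e : α} (heA : e ∈ A) (heB : e ∉ B) :
    ∃ f ∈ B, f ∉ A ∧ M.IsBase (insert f (A.erase e) : Finset α) ∧
      M.IsBase (insert e (B.erase f) : Finset α) := by
  have heE : e ∈ M.E := hA.subset_ground heA
  have hecl : e ∈ M.closure (B : Set α) := by rwa [hB.closure_eq]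
  have heB' : e ∉ (B : Set α) := by simpa using heB
  have hC := hB.fundCircuit_isCircuit heE heB'
  have hnot : ¬ (M.fundCircuit e B \ {e} ⊆ M.closure ((A : Set α) \ {e})) := fun h =>
    hA.indep.notMem_closure_sdiff_of_mem heA
      (M.closure_subset_closure_of_subset_closure h
        (hC.mem_closure_sdiff_singleton_of_mem (M.mem_fundCircuit e B)))
  obtain ⟨f, ⟨hfC, hfe⟩, hfcl⟩ := Set.not_subset.1 hnot
  have hfe' : f ≠ e := by simpa using hfe
  have hfB : f ∈ B := by
    simpa [hfe'] using M.fundCircuit_subset_insert e B hfC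
  have hfE : f ∈ M.E := hB.subset_ground hfB
  have hfA : f ∉ A := fun h => hfcl (M.mem_closure_of_mem' ⟨h, hfe⟩ hfE)
  refine ⟨f, hfB, hfA, ?_, ?_⟩
  · simpa using hA.exchange_base_of_notMem_closure heA hfcl hfE
  · have hind := (hB.indep.mem_fundCircuit_iff hecl heB').1 hfC
    rw [← Set.insert_sdiff_singleton_comm hfe'.symm] at hind
    simpa using hB.exchange_isBase_of_indep heB' hind

end Exchange

section RigidPair

variable {α G : Type*} [DecidableEq α] [AddCommGroup G]

/-- `A` is a minimum-weight base among those between `A ∩ B` and `A ∪ B`, and `B` is the only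
base in this interval that has the label sum of `B` and at most the weight of `B`. -/
structure IsRigidPair (M : Matroid α) (ℓ : α → G) (w : α → ℝ) (A B : Finset α) : Prop where
  isBase_left : M.IsBase (A : Set α)
  isBase_right : M.IsBase (B : Set α)
  weight_le : ∀ C : Finset α, M.IsBase (C : Set α) → A ∩ B ⊆ C → C ⊆ A ∪ B →
    ∑ e ∈ A, w e ≤ ∑ e ∈ C, w e
  eq_right : ∀ C : Finset α, M.IsBase (C : Set α) → A ∩ B ⊆ C → C ⊆ A ∪ B →
    ∑ e ∈ C, ℓ e = ∑ e ∈ B, ℓ e → ∑ e ∈ C, w e ≤ ∑ e ∈ B, w e → C = B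

theorem sum_exchange {N : Type*} [AddCommGroup N] (h : α → N) {A : Finset α} {a b : α}
    (ha : a ∈ A) (hb : b ∉ A) :
    ∑ e ∈ insert b (A.erase a), h e = ∑ e ∈ A, h e - h a + h b := by
  rw [Finset.sum_insert (by simp [hb]), Finset.sum_erase_eq_sub ha, add_comm]

variable {M : Matroid α} {ℓ : α → G} {w : α → ℝ} {A B : Finset α}

namespace IsRigidPair

theorem map_label {H : Type*} [AddCommGroup H] (h : IsRigidPair M ℓ w A B) (φ : G ≃+ H) :
    IsRigidPair M (fun e => φ (ℓ e)) w A B where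
  isBase_left := h.isBase_left
  isBase_right := h.isBase_right
  weight_le := h.weight_le
  eq_right C hC h₁ h₂ hℓ hw := h.eq_right C hC h₁ h₂
    (φ.injective (by simpa only [map_sum] using hℓ)) hw

theorem card_eq (h : IsRigidPair M ℓ w A B) : A.card = B.card := by
  simpa using congrArg ENat.toNat
    (h.isBase_left.encard_eq_encard_of_isBase h.isBase_right)

theorem card_sdiff_eq (h : IsRigidPair M ℓ w A B) : (A \ B).card = (B \ A).card :=
  Finset.card_sdiff_comm h.card_eq

theorem label_ne (h : IsRigidPair M ℓ w A B) (hAB : A ≠ B) :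
    ∑ e ∈ A, ℓ e ≠ ∑ e ∈ B, ℓ e := fun hℓ =>
  hAB (h.eq_right A h.isBase_left Finset.inter_subset_left Finset.subset_union_left hℓ
    (h.weight_le B h.isBase_right Finset.inter_subset_right Finset.subset_union_right))

variable {a b : α}

theorem weight_le_of_exchange_left (h : IsRigidPair M ℓ w A B) (ha : a ∈ A \ B) (hb : b ∈ B \ A)
    (hab : M.IsBase (insert b (A.erase a) : Finset α)) : w a ≤ w b := by
  rw [Finset.mem_sdiff] at ha hb
  have := h.weight_le _ hab (by grind) (by grind)
  rw [sum_exchange w ha.1 hb.2] at this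
  linarith

theorem weight_le_of_exchange_right (h : IsRigidPair M ℓ w A B) (ha : a ∈ A \ B)
    (hb : b ∈ B \ A) (hab : M.IsBase (insert a (B.erase b) : Finset α)) :
    ∑ e ∈ A, w e - w a ≤ ∑ e ∈ B, w e - w b := by
  rw [Finset.mem_sdiff] at ha hb
  have := h.weight_le _ hab (by grind) (by grind)
  rw [sum_exchange w hb.1 ha.2] at this
  linarith

theorem label_ne_of_exchange_right (h : IsRigidPair M ℓ w A B) (ha : a ∈ A \ B) (hb : b ∈ B \ A)
    (hab : M.IsBase (insert a (B.erase b) : Finset α)) (hw : w a ≤ w b) : ℓ a - ℓ b ≠ 0 := by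
  rw [Finset.mem_sdiff] at ha hb
  intro h0
  have heq := h.eq_right _ hab (by grind) (by grind)
    (by rw [sum_exchange ℓ hb.1 ha.2, sub_eq_zero.1 h0]; abel)
    (by rw [sum_exchange w hb.1 ha.2]; linarith)
  exact ha.2 (heq ▸ Finset.mem_insert_self a _)

theorem label_ne_of_exchange_left (h : IsRigidPair M ℓ w A B) (hcard : 1 < (A \ B).card)
    (ha : a ∈ A \ B) (hb : b ∈ B \ A)
    (hab : M.IsBase (insert b (A.erase a) : Finset α))
    (hw : ∑ e ∈ A, w e - w a ≤ ∑ e ∈ B, w e - w b) :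
    ℓ a - ℓ b ≠ ∑ e ∈ A, ℓ e - ∑ e ∈ B, ℓ e := by
  obtain ⟨c, hc, hca⟩ := Finset.exists_mem_ne hcard a
  rw [Finset.mem_sdiff] at ha hb hc
  intro h0
  have heq := h.eq_right _ hab (by grind) (by grind)
    (by rw [sum_exchange ℓ ha.1 hb.2, sub_add, h0]; abel)
    (by rw [sum_exchange w ha.1 hb.2]; linarith)
  exact hc.2 (heq ▸ Finset.mem_insert_of_mem (Finset.mem_erase.2 ⟨hca, hc.1⟩))

theorem label_ne_of_symmetric_exchange (h : IsRigidPair M ℓ w A B) (hcard : 1 < (A \ B).card)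
    (ha : a ∈ A \ B) (hb : b ∈ B \ A)
    (hl : M.IsBase (insert b (A.erase a) : Finset α))
    (hr : M.IsBase (insert a (B.erase b) : Finset α)) :
    ℓ a - ℓ b ≠ 0 ∧ ℓ a - ℓ b ≠ ∑ e ∈ A, ℓ e - ∑ e ∈ B, ℓ e :=
  ⟨h.label_ne_of_exchange_right ha hb hr (h.weight_le_of_exchange_left ha hb hl),
    h.label_ne_of_exchange_left hcard ha hb hl (h.weight_le_of_exchange_right ha hb hr)⟩

theorem exchange_of_weight_le (h : IsRigidPair M ℓ w A B) (ha : a ∈ A \ B) (hb : b ∈ B \ A)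
    (hab : M.IsBase (insert b (A.erase a) : Finset α))
    (hw : ∀ C : Finset α, M.IsBase (C : Set α) → A ∩ B ⊆ C → C ⊆ A ∪ B → b ∈ C → a ∉ C →
      ∑ e ∈ A, w e - w a + w b ≤ ∑ e ∈ C, w e) :
    IsRigidPair M ℓ w (insert b (A.erase a)) B := by
  rw [Finset.mem_sdiff] at ha hb
  have key : ∀ C : Finset α, insert b (A.erase a) ∩ B ⊆ C → C ⊆ insert b (A.erase a) ∪ B →
      A ∩ B ⊆ C ∧ C ⊆ A ∪ B ∧ b ∈ C ∧ a ∉ C := by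
    intro C h₁ h₂
    refine ⟨by grind, by grind, by grind, by grind⟩
  refine ⟨hab, h.isBase_right, fun C hC h₁ h₂ => ?_, fun C hC h₁ h₂ => ?_⟩
  · obtain ⟨k₁, k₂, k₃, k₄⟩ := key C h₁ h₂
    rw [sum_exchange w ha.1 hb.2]
    exact hw C hC k₁ k₂ k₃ k₄
  · obtain ⟨k₁, k₂, -, -⟩ := key C h₁ h₂
    exact h.eq_right C hC k₁ k₂

theorem exists_exchange_of_mem_right (h : IsRigidPair M ℓ w A B) (hb : b ∈ B \ A) :
    ∃ a ∈ A \ B, IsRigidPair M ℓ w (insert b (A.erase a)) B := by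
  classical
  have hb' := Finset.mem_sdiff.1 hb
  let T := {a ∈ A \ B | M.IsBase (insert b (A.erase a) : Finset α)}
  have hT : T.Nonempty := by
    obtain ⟨a, haA, haB, -, hab⟩ :=
      exists_symmetric_exchange h.isBase_right h.isBase_left hb'.1 hb'.2
    exact ⟨a, by simp only [T, Finset.mem_filter, Finset.mem_sdiff]; exact ⟨⟨haA, haB⟩, hab⟩⟩
  obtain ⟨a, haT, hmax⟩ := T.exists_max_image w hT
  have haT' := Finset.mem_filter.1 haT
  refine ⟨a, haT'.1, h.exchange_of_weight_le haT'.1 hb haT'.2 fun C hC h₁ h₂ hbC haC => ?_⟩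
  obtain ⟨x, hxA, hxC, hCx, hAx⟩ := exists_symmetric_exchange hC h.isBase_left hbC hb'.2
  have hxB : x ∉ B := fun hxB => hxC (h₁ (Finset.mem_inter.2 ⟨hxA, hxB⟩))
  have hwx := hmax x (Finset.mem_filter.2 ⟨Finset.mem_sdiff.2 ⟨hxA, hxB⟩, hAx⟩)
  have := h.weight_le _ hCx (by grind) (by grind)
  rw [sum_exchange w hbC hxC] at this
  linarith

theorem exists_exchange_of_mem_left (h : IsRigidPair M ℓ w A B) (ha : a ∈ A \ B) :
    ∃ b ∈ B \ A, IsRigidPair M ℓ w (insert b (A.erase a)) B := by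
  classical
  have ha' := Finset.mem_sdiff.1 ha
  let T := {b ∈ B \ A | M.IsBase (insert b (A.erase a) : Finset α)}
  have hT : T.Nonempty := by
    obtain ⟨b, hbB, hbA, hab, -⟩ :=
      exists_symmetric_exchange h.isBase_left h.isBase_right ha'.1 ha'.2
    exact ⟨b, by simp only [T, Finset.mem_filter, Finset.mem_sdiff]; exact ⟨⟨hbB, hbA⟩, hab⟩⟩
  obtain ⟨b, hbT, hmin⟩ := T.exists_min_image w hT
  have hbT' := Finset.mem_filter.1 hbT
  refine ⟨b, hbT'.1, h.exchange_of_weight_le ha hbT'.1 hbT'.2 fun C hC h₁ h₂ hbC haC => ?_⟩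
  obtain ⟨y, hyC, hyA, hAy, hCy⟩ := exists_symmetric_exchange h.isBase_left hC ha'.1 haC
  have hyB : y ∈ B := (Finset.mem_union.1 (h₂ hyC)).resolve_left hyA
  have hwy := hmin y (Finset.mem_filter.2 ⟨Finset.mem_sdiff.2 ⟨hyB, hyA⟩, hAy⟩)
  have := h.weight_le _ hCy (by grind) (by grind)
  rw [sum_exchange w hyC haC] at this
  linarith

theorem exchange_sdiff (ha : a ∈ A \ B) (hb : b ∈ B \ A) :
    insert b (A.erase a) \ B = (A \ B).erase a ∧ B \ insert b (A.erase a) = (B \ A).erase b := by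
  rw [Finset.mem_sdiff] at ha hb
  constructor <;> ext x <;> grind

/-- The distance of a rigid pair can be lowered to any smaller value. -/
theorem exists_card_sdiff_eq (h : IsRigidPair M ℓ w A B) {n : ℕ} (hn : n ≤ (A \ B).card) :
    ∃ A', IsRigidPair M ℓ w A' B ∧ (A' \ B).card = n := by
  induction hk : (A \ B).card - n generalizing A with
  | zero => exact ⟨A, h, by omega⟩
  | succ k ih =>
    obtain ⟨a, ha⟩ := Finset.card_pos.1 (show 0 < (A \ B).card by omega)
    obtain ⟨b, hb, h'⟩ := h.exists_exchange_of_mem_left ha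
    have hc : (insert b (A.erase a) \ B).card = (A \ B).card - 1 := by
      rw [(exchange_sdiff ha hb).1, Finset.card_erase_of_mem ha]
    exact ih h' (by omega) (by omega)

end IsRigidPair

end RigidPair

section RigidTriple

/-- The constraints on the labels `x₁, x₂, x₃` of `A \ B` and `y₁, y₂, y₃` of `B \ A` that a rigid
pair at distance three imposes; `d` is the difference of the label sums. -/
def IsRigidTriple {G : Type*} [AddCommGroup G] (x₁ x₂ x₃ y₁ y₂ y₃ d : G) : Prop :=
  d ≠ 0 ∧ ((x₁ - y₁ ≠ 0 ∧ x₁ - y₁ ≠ d) ∧ (x₃ - y₃ ≠ 0 ∧ x₃ - y₃ ≠ d)) ∧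
    ((x₂ - y₂ ≠ 0 ∧ x₂ - y₂ ≠ d) ∨
      (x₂ - y₁ ≠ 0 ∧ x₂ - y₁ ≠ d) ∧ (x₃ - y₂ ≠ 0 ∧ x₃ - y₂ ≠ d) ∧
        x₃ - y₁ ≠ d ∧ x₁ - y₂ ≠ d ∧ x₂ - y₃ ≠ d)

instance {G : Type*} [AddCommGroup G] [DecidableEq G] (x₁ x₂ x₃ y₁ y₂ y₃ d : G) :
    Decidable (IsRigidTriple x₁ x₂ x₃ y₁ y₂ y₃ d) := by
  unfold IsRigidTriple
  infer_instance

theorem not_isRigidTriple_zmod_three : ∀ x₁ x₂ x₃ y₁ y₂ y₃ : ZMod 3,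
    ¬ IsRigidTriple x₁ x₂ x₃ y₁ y₂ y₃ (x₁ + x₂ + x₃ - (y₁ + y₂ + y₃)) := by
  decide +kernel

theorem not_isRigidTriple_zmod_two_prod : ∀ x₁ x₂ x₃ y₁ y₂ y₃ : ZMod 2 × ZMod 2,
    ¬ IsRigidTriple x₁ x₂ x₃ y₁ y₂ y₃ (x₁ + x₂ + x₃ - (y₁ + y₂ + y₃)) := by
  decide +kernel

theorem IsRigidTriple.exists_shift_zmod_four : ∀ x₁ x₂ x₃ y₁ y₂ y₃ : ZMod 4,
    IsRigidTriple x₁ x₂ x₃ y₁ y₂ y₃ (x₁ + x₂ + x₃ - (y₁ + y₂ + y₃)) →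
    ∃ t : ZMod 4, (t = 1 ∨ t = -1) ∧
      ({x₁, x₂, x₃} : Multiset (ZMod 4)) = {y₁ + t, y₂ + t, y₃ + t} := by
  decide +kernel

/-- A bipartite graph on `3 + 3` vertices without isolated vertices has a perfect matching or is,
up to a possible extra edge, the disjoint union of two stars with two edges. -/
theorem exists_matching_or_stars : ∀ s : Fin 3 → Fin 3 → Bool,
    (∀ i, ∃ j, s i j) → (∀ j, ∃ i, s i j) →
    ∃ σ τ : Equiv.Perm (Fin 3), (∀ i, s (σ i) (τ i)) ∨
      (s (σ 0) (τ 0) ∧ s (σ 1) (τ 0) ∧ s (σ 2) (τ 1) ∧ s (σ 2) (τ 2) ∧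
        ¬ s (σ 0) (τ 1) ∧ ¬ s (σ 0) (τ 2) ∧ ¬ s (σ 1) (τ 1) ∧ ¬ s (σ 1) (τ 2)) := by
  decide +kernel

end RigidTriple

namespace IsRigidPair

variable {α G : Type*} [DecidableEq α] [AddCommGroup G]
variable {M : Matroid α} {ℓ : α → G} {w : α → ℝ} {A B : Finset α}

/-- The double-star case at distance three: single exchanges force three further exchanges. -/
theorem label_ne_of_stars (h : IsRigidPair M ℓ w A B) {a₁ a₂ a₃ b₁ b₂ b₃ : α}
    (hA : A \ B = {a₁, a₂, a₃}) (hB : B \ A = {b₁, b₂, b₃})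
    (ha₁₂ : a₁ ≠ a₂) (ha₁₃ : a₁ ≠ a₃) (ha₂₃ : a₂ ≠ a₃)
    (hb₁₂ : b₁ ≠ b₂) (hb₁₃ : b₁ ≠ b₃) (hb₂₃ : b₂ ≠ b₃)
    {S : α → α → Prop} (hS : ∀ a b, S a b ↔ M.IsBase (insert b (A.erase a) : Finset α) ∧
      M.IsBase (insert a (B.erase b) : Finset α))
    (h₁₁ : S a₁ b₁) (h₂₁ : S a₂ b₁) (h₃₂ : S a₃ b₂) (h₃₃ : S a₃ b₃)
    (h₁₂ : ¬ S a₁ b₂) (h₁₃ : ¬ S a₁ b₃) (h₂₃ : ¬ S a₂ b₃)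
    (hE : M.IsBase (insert b₂ (A.erase a₁) : Finset α)) :
    ℓ a₃ - ℓ b₁ ≠ ∑ e ∈ A, ℓ e - ∑ e ∈ B, ℓ e ∧ ℓ a₁ - ℓ b₂ ≠ ∑ e ∈ A, ℓ e - ∑ e ∈ B, ℓ e ∧
      ℓ a₂ - ℓ b₃ ≠ ∑ e ∈ A, ℓ e - ∑ e ∈ B, ℓ e := by
  simp only [hS] at h₁₁ h₂₁ h₃₂ h₃₃ h₁₂ h₁₃ h₂₃
  have hmA : ∀ x, (x ∈ A ∧ x ∉ B) ↔ x = a₁ ∨ x = a₂ ∨ x = a₃ := fun x => by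
    rw [← Finset.mem_sdiff, hA]; simp
  have hmB : ∀ x, (x ∈ B ∧ x ∉ A) ↔ x = b₁ ∨ x = b₂ ∨ x = b₃ := fun x => by
    rw [← Finset.mem_sdiff, hB]; simp
  have a₁m := (hmA a₁).2 (by simp)
  have a₂m := (hmA a₂).2 (by simp)
  have a₃m := (hmA a₃).2 (by simp)
  have b₁m := (hmB b₁).2 (by simp)
  have b₂m := (hmB b₂).2 (by simp)
  have b₃m := (hmB b₃).2 (by simp)
  have hr₁₂ : ¬ M.IsBase (insert a₁ (B.erase b₂) : Finset α) := fun hc => h₁₂ ⟨hE, hc⟩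
  have hr₁₃ : M.IsBase (insert a₁ (B.erase b₃) : Finset α) := by
    obtain ⟨y, hyB, hyN, -, hy⟩ := exists_symmetric_exchange (e := a₁) h₂₁.1 h.isBase_right
      (by grind) (by grind)
    obtain rfl | rfl | rfl := (hmB y).1 (by grind)
    · simp at hyN
    · exact absurd hy hr₁₂
    · exact hy
  have hl₁₃ : ¬ M.IsBase (insert b₃ (A.erase a₁) : Finset α) := fun hc => h₁₃ ⟨hc, hr₁₃⟩
  have hl₂₃ : M.IsBase (insert b₃ (A.erase a₂) : Finset α) := by
    obtain ⟨x, hxA, hxN, -, hx⟩ := exists_symmetric_exchange (e := b₃) h₃₂.2 h.isBase_left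
      (by grind) (by grind)
    obtain rfl | rfl | rfl := (hmA x).1 (by grind)
    · exact absurd hx hl₁₃
    · exact hx
    · simp at hxN
  have hr₂₃ : ¬ M.IsBase (insert a₂ (B.erase b₃) : Finset α) := fun hc => h₂₃ ⟨hl₂₃, hc⟩
  have hr₂₂ : M.IsBase (insert a₂ (B.erase b₂) : Finset α) := by
    obtain ⟨y, hyB, hyN, -, hy⟩ := exists_symmetric_exchange (e := a₂) h₁₁.1 h.isBase_right
      (by grind) (by grind)
    obtain rfl | rfl | rfl := (hmB y).1 (by grind)
    · simp at hyN
    · exact hy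
    · exact absurd hy hr₂₃
  have hl₃₁ : M.IsBase (insert b₁ (A.erase a₃) : Finset α) := by
    obtain ⟨x, hxP, hxQ, -, hx⟩ := exists_symmetric_exchange (e := a₁) h₂₁.1 hr₂₂
      (by grind) (by grind)
    have hx' : x = a₂ ∨ x = b₃ := by
      have := hmA x
      have := hmB x
      grind
    obtain rfl | rfl := hx'
    · refine absurd ?_ hr₁₂
      rwa [Finset.erase_insert (by grind)] at hx
    · convert hx using 2
      ext z
      have := hmA z
      have := hmB z
      grind
  have hcard : 1 < (A \ B).card := Finset.one_lt_card.2
    ⟨a₁, by simp [hA], a₂, by simp [hA], ha₁₂⟩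
  have hw : ∑ e ∈ A, w e - ∑ e ∈ B, w e = w a₁ + w a₂ + w a₃ - (w b₁ + w b₂ + w b₃) := by
    rw [← Finset.sum_sdiff_sub_sum_sdiff, hA, hB, Finset.sum_insert (by simp [ha₁₂, ha₁₃]),
      Finset.sum_pair ha₂₃, Finset.sum_insert (by simp [hb₁₂, hb₁₃]), Finset.sum_pair hb₂₃]
    ring
  have hle : ∀ {a b}, a ∈ A ∧ a ∉ B → b ∈ B ∧ b ∉ A →
      M.IsBase (insert b (A.erase a) : Finset α) → w a ≤ w b := fun ha hb =>
    h.weight_le_of_exchange_left (Finset.mem_sdiff.2 ha) (Finset.mem_sdiff.2 hb)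
  have hne : ∀ {a b}, a ∈ A ∧ a ∉ B → b ∈ B ∧ b ∉ A →
      M.IsBase (insert b (A.erase a) : Finset α) →
      ∑ e ∈ A, w e - w a ≤ ∑ e ∈ B, w e - w b →
      ℓ a - ℓ b ≠ ∑ e ∈ A, ℓ e - ∑ e ∈ B, ℓ e := fun ha hb =>
    h.label_ne_of_exchange_left hcard (Finset.mem_sdiff.2 ha) (Finset.mem_sdiff.2 hb)
  refine ⟨hne a₃m b₁m hl₃₁ ?_, hne a₁m b₂m hE ?_, hne a₂m b₃m hl₂₃ ?_⟩
  · linarith [hle a₁m b₂m hE, hle a₂m b₃m hl₂₃]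
  · linarith [hle a₂m b₁m h₂₁.1, hle a₃m b₃m h₃₃.1]
  · linarith [hle a₁m b₁m h₁₁.1, hle a₃m b₂m h₃₂.1]

theorem exists_isRigidTriple (h : IsRigidPair M ℓ w A B) (hcard : (A \ B).card = 3) :
    ∃ x₁ x₂ x₃ y₁ y₂ y₃ : G, (A \ B).val.map ℓ = {x₁, x₂, x₃} ∧ (B \ A).val.map ℓ = {y₁, y₂, y₃} ∧
      IsRigidTriple x₁ x₂ x₃ y₁ y₂ y₃ (x₁ + x₂ + x₃ - (y₁ + y₂ + y₃)) := by
  classical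
  have hcardB : (B \ A).card = 3 := h.card_sdiff_eq ▸ hcard
  let S : α → α → Prop := fun a b => M.IsBase (insert b (A.erase a) : Finset α) ∧
      M.IsBase (insert a (B.erase b) : Finset α)
  let p := (Finset.equivFinOfCardEq hcard).symm
  let q := (Finset.equivFinOfCardEq hcardB).symm
  obtain ⟨σ, τ, hστ⟩ := exists_matching_or_stars (fun i j => decide (S (p i) (q j)))
    (fun i => by
      have hi := Finset.mem_sdiff.1 (p i).2
      obtain ⟨b, hbB, hbA, h₁, h₂⟩ :=
        exists_symmetric_exchange h.isBase_left h.isBase_right hi.1 hi.2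
      obtain ⟨j, hj⟩ := q.surjective ⟨b, Finset.mem_sdiff.2 ⟨hbB, hbA⟩⟩
      exact ⟨j, decide_eq_true (by rw [hj]; exact ⟨h₁, h₂⟩)⟩)
    (fun j => by
      have hj := Finset.mem_sdiff.1 (q j).2
      obtain ⟨a, haA, haB, h₁, h₂⟩ :=
        exists_symmetric_exchange h.isBase_right h.isBase_left hj.1 hj.2
      obtain ⟨i, hi⟩ := p.surjective ⟨a, Finset.mem_sdiff.2 ⟨haA, haB⟩⟩
      exact ⟨i, decide_eq_true (by rw [hi]; exact ⟨h₂, h₁⟩)⟩)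
  have enum : ∀ {T : Finset α} (r : Fin 3 ≃ T), T = {(r 0 : α), (r 1 : α), (r 2 : α)} ∧
      (r 0 : α) ≠ r 1 ∧ (r 0 : α) ≠ r 2 ∧ (r 1 : α) ≠ r 2 := by
    intro T r
    refine ⟨?_, by simp, by simp, by simp⟩
    ext z
    constructor
    · intro hz
      obtain ⟨i, hi⟩ := r.surjective ⟨z, hz⟩
      fin_cases i <;> simp at hi <;> simp [hi]
    · simp only [Finset.mem_insert, Finset.mem_singleton]
      rintro (rfl | rfl | rfl) <;> exact Subtype.property _
  obtain ⟨hA, ha₁₂, ha₁₃, ha₂₃⟩ := enum (σ.trans p)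
  obtain ⟨hB, hb₁₂, hb₁₃, hb₂₃⟩ := enum (τ.trans q)
  simp only [decide_eq_true_eq] at hστ
  simp only [Equiv.trans_apply] at hA ha₁₂ ha₁₃ ha₂₃ hB hb₁₂ hb₁₃ hb₂₃
  have hστ' : (S (p (σ 0)) (q (τ 0)) ∧ S (p (σ 1)) (q (τ 1)) ∧ S (p (σ 2)) (q (τ 2))) ∨ _ :=
    hστ.imp_left fun hs => ⟨hs 0, hs 1, hs 2⟩
  clear hστ
  generalize (p (σ 0) : α) = a₁ at *
  generalize (p (σ 1) : α) = a₂ at *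
  generalize (p (σ 2) : α) = a₃ at *
  generalize (q (τ 0) : α) = b₁ at *
  generalize (q (τ 1) : α) = b₂ at *
  generalize (q (τ 2) : α) = b₃ at *
  have hmapA : (A \ B).val.map ℓ = {ℓ a₁, ℓ a₂, ℓ a₃} := by
    rw [hA, Finset.insert_val_of_notMem (by simp [ha₁₂, ha₁₃]),
      Finset.insert_val_of_notMem (by simp [ha₂₃])]
    simp
  have hmapB : (B \ A).val.map ℓ = {ℓ b₁, ℓ b₂, ℓ b₃} := by
    rw [hB, Finset.insert_val_of_notMem (by simp [hb₁₂, hb₁₃]),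
      Finset.insert_val_of_notMem (by simp [hb₂₃])]
    simp
  have hd : ∑ e ∈ A, ℓ e - ∑ e ∈ B, ℓ e = ℓ a₁ + ℓ a₂ + ℓ a₃ - (ℓ b₁ + ℓ b₂ + ℓ b₃) := by
    rw [← Finset.sum_sdiff_sub_sum_sdiff, Finset.sum_eq_multiset_sum, Finset.sum_eq_multiset_sum,
      hmapA, hmapB]
    simp [add_assoc]
  have hd0 : ∑ e ∈ A, ℓ e - ∑ e ∈ B, ℓ e ≠ 0 :=
    sub_ne_zero.2 (h.label_ne (by rintro rfl; simp at hcard))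
  have hne : ∀ {a b}, a ∈ A \ B → b ∈ B \ A → S a b →
      ℓ a - ℓ b ≠ 0 ∧ ℓ a - ℓ b ≠ ∑ e ∈ A, ℓ e - ∑ e ∈ B, ℓ e := fun ha hb hs =>
    h.label_ne_of_symmetric_exchange (by omega) ha hb hs.1 hs.2
  have a₁m : a₁ ∈ A \ B := by simp [hA]
  have a₂m : a₂ ∈ A \ B := by simp [hA]
  have a₃m : a₃ ∈ A \ B := by simp [hA]
  have b₁m : b₁ ∈ B \ A := by simp [hB]
  have b₂m : b₂ ∈ B \ A := by simp [hB]
  have b₃m : b₃ ∈ B \ A := by simp [hB]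
  obtain ⟨h₁₁, h₂₂, h₃₃⟩ | ⟨h₁₁, h₂₁, h₃₂, h₃₃, h₁₂, h₁₃, h₂₂, h₂₃⟩ := hστ'
  · exact ⟨_, _, _, _, _, _, hmapA, hmapB, hd ▸ hd0, hd ▸ ⟨hne a₁m b₁m h₁₁, hne a₃m b₃m h₃₃⟩,
      Or.inl (hd ▸ hne a₂m b₂m h₂₂)⟩
  by_cases hE : M.IsBase (insert b₂ (A.erase a₁) : Finset α)
  · have hs := h.label_ne_of_stars hA hB ha₁₂ ha₁₃ ha₂₃ hb₁₂ hb₁₃ hb₂₃ (fun _ _ => Iff.rfl)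
      h₁₁ h₂₁ h₃₂ h₃₃ h₁₂ h₁₃ h₂₃ hE
    exact ⟨_, _, _, _, _, _, hmapA, hmapB, hd ▸ hd0, hd ▸ ⟨hne a₁m b₁m h₁₁, hne a₃m b₃m h₃₃⟩,
      Or.inr (hd ▸ ⟨hne a₂m b₁m h₂₁, hne a₃m b₂m h₃₂, hs⟩)⟩
  · have hE' : M.IsBase (insert b₂ (A.erase a₂) : Finset α) := by
      obtain ⟨x, hxA, hxN, -, hx⟩ := exists_symmetric_exchange (e := b₂) h₃₃.2 h.isBase_left
        (by grind) (by grind)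
      have hx' : x ∈ A \ B := by grind
      simp only [hA, Finset.mem_insert, Finset.mem_singleton] at hx'
      obtain rfl | rfl | rfl := hx'
      · exact absurd hx hE
      · exact hx
      · simp at hxN
    have hA' : A \ B = {a₂, a₁, a₃} := by rw [hA, Finset.insert_comm]
    have hs := h.label_ne_of_stars hA' hB ha₁₂.symm ha₂₃ ha₁₃ hb₁₂ hb₁₃ hb₂₃
      (fun _ _ => Iff.rfl) h₂₁ h₁₁ h₃₂ h₃₃ h₂₂ h₂₃ h₁₃ hE'
    have hmapA' : (A \ B).val.map ℓ = {ℓ a₂, ℓ a₁, ℓ a₃} := by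
      rw [hmapA]
      exact Multiset.cons_swap _ _ _
    rw [add_comm (ℓ a₁)] at hd
    exact ⟨_, _, _, _, _, _, hmapA', hmapB, hd ▸ hd0, hd ▸ ⟨hne a₂m b₁m h₂₁, hne a₃m b₃m h₃₃⟩,
      Or.inr (hd ▸ ⟨hne a₁m b₁m h₁₁, hne a₃m b₂m h₃₂, hs⟩)⟩

end IsRigidPair

section ZModFour

/-- Removing `x` from `X` and `y` from `Y` leaves multisets that differ by a shift by `±1`. -/
def IsUnitShift (X Y : Multiset (ZMod 4)) (x y : ZMod 4) : Prop :=
  X.erase x = (Y.erase y).map (· + 1) ∨ X.erase x = (Y.erase y).map (· + -1)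

instance (X Y : Multiset (ZMod 4)) (x y : ZMod 4) : Decidable (IsUnitShift X Y x y) := by
  unfold IsUnitShift
  infer_instance

theorem not_forall_exists_isUnitShift_of_eq : ∀ y₁ y₂ y₃ y₄ x t : ZMod 4, t = 1 ∨ t = -1 →
    ∀ X ∈ [({x, y₁ + t, y₂ + t, y₃ + t} : Multiset (ZMod 4))],
    ∀ Y ∈ [({y₄, y₁, y₂, y₃} : Multiset (ZMod 4))], X.sum ≠ Y.sum →
    ¬ ((∀ x ∈ X, ∃ y ∈ Y, IsUnitShift X Y x y) ∧ (∀ y ∈ Y, ∃ x ∈ X, IsUnitShift X Y x y)) := by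
  decide +kernel

theorem not_forall_exists_isUnitShift {X Y : Multiset (ZMod 4)} (hY : Y.card = 4)
    (hXY : X.sum ≠ Y.sum) (hl : ∀ x ∈ X, ∃ y ∈ Y, IsUnitShift X Y x y)
    (hr : ∀ y ∈ Y, ∃ x ∈ X, IsUnitShift X Y x y) : False := by
  obtain ⟨y₄, hy₄⟩ := Multiset.card_pos_iff_exists_mem.1 (show 0 < Y.card by omega)
  obtain ⟨x, hx, hs⟩ := hr y₄ hy₄
  obtain ⟨t, ht, hs⟩ : ∃ t : ZMod 4, (t = 1 ∨ t = -1) ∧ X.erase x = (Y.erase y₄).map (· + t) :=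
    hs.elim (fun h => ⟨1, by simp, h⟩) (fun h => ⟨-1, by simp, h⟩)
  obtain ⟨y₁, y₂, y₃, hY'⟩ := Multiset.card_eq_three.1
    (show (Y.erase y₄).card = 3 by rw [Multiset.card_erase_of_mem hy₄, hY]; rfl)
  have hXe : X = {x, y₁ + t, y₂ + t, y₃ + t} := by
    rw [← Multiset.cons_erase hx, hs, hY']
    simp
  have hYe : Y = {y₄, y₁, y₂, y₃} := by
    rw [← Multiset.cons_erase hy₄, hY']
    simp
  exact not_forall_exists_isUnitShift_of_eq y₁ y₂ y₃ y₄ x t ht X (by simp [hXe]) Y (by simp [hYe])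
    hXY ⟨hl, hr⟩

end ZModFour

namespace IsRigidPair

variable {α G : Type*} [DecidableEq α] [AddCommGroup G] {M : Matroid α} {w : α → ℝ}
  {A B : Finset α}

theorem card_sdiff_ne_one [Subsingleton G] {ℓ : α → G} (h : IsRigidPair M ℓ w A B) :
    (A \ B).card ≠ 1 := fun hcard =>
  h.label_ne (by rintro rfl; simp at hcard) (Subsingleton.elim _ _)

theorem card_sdiff_ne_two {ℓ : α → ZMod 2} (h : IsRigidPair M ℓ w A B) :
    (A \ B).card ≠ 2 := fun hcard => by
  have hd := sub_ne_zero.2 (h.label_ne (by rintro rfl; simp at hcard))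
  obtain ⟨a, ha⟩ := Finset.card_pos.1 (show 0 < (A \ B).card by omega)
  have ha' := Finset.mem_sdiff.1 ha
  obtain ⟨b, hbB, hbA, hl, hr⟩ :=
    exists_symmetric_exchange h.isBase_left h.isBase_right ha'.1 ha'.2
  obtain ⟨h₀, h₁⟩ := h.label_ne_of_symmetric_exchange (by omega) ha
    (Finset.mem_sdiff.2 ⟨hbB, hbA⟩) hl hr
  generalize ℓ a - ℓ b = t at *
  generalize ∑ e ∈ A, ℓ e - ∑ e ∈ B, ℓ e = d at *
  revert t d
  decide

theorem card_sdiff_ne_three {ℓ : α → ZMod 3} (h : IsRigidPair M ℓ w A B) :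
    (A \ B).card ≠ 3 := fun hcard => by
  obtain ⟨x₁, x₂, x₃, y₁, y₂, y₃, -, -, ht⟩ := h.exists_isRigidTriple hcard
  exact not_isRigidTriple_zmod_three _ _ _ _ _ _ ht

theorem card_sdiff_ne_three_of_zmod_two_prod {ℓ : α → ZMod 2 × ZMod 2}
    (h : IsRigidPair M ℓ w A B) : (A \ B).card ≠ 3 := fun hcard => by
  obtain ⟨x₁, x₂, x₃, y₁, y₂, y₃, -, -, ht⟩ := h.exists_isRigidTriple hcard
  exact not_isRigidTriple_zmod_two_prod _ _ _ _ _ _ ht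

theorem isUnitShift_of_exchange {ℓ : α → ZMod 4} {a b : α} (hcard : (A \ B).card = 4)
    (ha : a ∈ A \ B) (hb : b ∈ B \ A) (h : IsRigidPair M ℓ w (insert b (A.erase a)) B) :
    IsUnitShift ((A \ B).val.map ℓ) ((B \ A).val.map ℓ) (ℓ a) (ℓ b) := by
  obtain ⟨hA, hB⟩ := exchange_sdiff ha hb
  obtain ⟨x₁, x₂, x₃, y₁, y₂, y₃, hX, hY, ht⟩ := h.exists_isRigidTriple
    (by rw [hA, Finset.card_erase_of_mem ha, hcard])
  obtain ⟨t, ht, hXY⟩ := IsRigidTriple.exists_shift_zmod_four _ _ _ _ _ _ ht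
  rw [hA, Finset.erase_val, Multiset.map_erase_of_mem _ _ ha] at hX
  rw [hB, Finset.erase_val, Multiset.map_erase_of_mem _ _ hb] at hY
  have hs : ((A \ B).val.map ℓ).erase (ℓ a) = (((B \ A).val.map ℓ).erase (ℓ b)).map (· + t) := by
    rw [hX, hY, hXY]
    simp
  obtain rfl | rfl := ht
  · exact Or.inl hs
  · exact Or.inr hs

theorem card_sdiff_ne_four {ℓ : α → ZMod 4} (h : IsRigidPair M ℓ w A B) :
    (A \ B).card ≠ 4 := fun hcard => by
  refine not_forall_exists_isUnitShift (X := (A \ B).val.map ℓ) (Y := (B \ A).val.map ℓ)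
    (by rw [Multiset.card_map, Finset.card_val, ← h.card_sdiff_eq, hcard]) ?_ ?_ ?_
  · have hd := sub_ne_zero.2 (h.label_ne (by rintro rfl; simp at hcard))
    rw [← Finset.sum_sdiff_sub_sum_sdiff] at hd
    exact sub_ne_zero.1 hd
  · intro x hx
    obtain ⟨a, ha, rfl⟩ := Multiset.mem_map.1 hx
    obtain ⟨b, hb, h'⟩ := h.exists_exchange_of_mem_left ha
    exact ⟨ℓ b, Multiset.mem_map_of_mem ℓ hb, isUnitShift_of_exchange hcard ha hb h'⟩
  · intro y hy
    obtain ⟨b, hb, rfl⟩ := Multiset.mem_map.1 hy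
    obtain ⟨a, ha, h'⟩ := h.exists_exchange_of_mem_right hb
    exact ⟨ℓ a, Multiset.mem_map_of_mem ℓ ha, isUnitShift_of_exchange hcard ha hb h'⟩

end IsRigidPair

section StronglyClose

/-- If no rigid pair has distance `k + 1`, then `G` is strongly `m`-close for all `m ≥ k`. -/
theorem isStronglyClose_of_card_sdiff_ne {G : Type u} [AddCommGroup G] {k m : ℕ} (hkm : k ≤ m)
    (H : ∀ (α : Type v) [DecidableEq α] (M : Matroid α) (ℓ : α → G) (w : α → ℝ) (A B : Finset α),
      IsRigidPair M ℓ w A B → (A \ B).card ≠ k + 1) :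
    IsStronglyClose.{u, v} G m := by
  classical
  intro α M hM ℓ w g hg A hA
  have hfin : {B : Finset α | IsLabelBase M ℓ g B}.Finite := by
    refine (M.ground_finite.toFinset.powerset.finite_toSet).subset fun B hB => ?_
    have : (B : Set α) ⊆ M.E := hB.1.subset_ground
    simpa [Finset.subset_iff, Set.subset_def] using this
  obtain ⟨B₀, hB₀, hmin₀⟩ := Set.exists_min_image _ (fun B => ∑ e ∈ B, w e) hfin hg
  have hfin' : {B : Finset α | IsOptLabelBase M ℓ w g B}.Finite := hfin.subset fun B hB => hB.1
  obtain ⟨B, hB, hmin⟩ := Set.exists_min_image _ (fun B => (A \ B).card) hfin'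
    ⟨B₀, hB₀, hmin₀⟩
  have hpair : IsRigidPair M ℓ w A B := by
    refine ⟨hA.1, hB.1.1, fun C hC _ _ => hA.2 C hC, fun C hC h₁ h₂ hℓ hw => ?_⟩
    have hCopt : IsOptLabelBase M ℓ w g C :=
      ⟨⟨hC, hℓ.trans hB.1.2⟩, fun B' hB' => hw.trans (hB.2 B' hB')⟩
    have hcard : C.card = B.card := by
      simpa using congrArg ENat.toNat (hC.encard_eq_encard_of_isBase hB.1.1)
    have hsub : A \ C ⊆ A \ B := by grind
    have hAC : A \ C = A \ B := Finset.eq_of_subset_of_card_le hsub (hmin C hCopt)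
    refine Finset.eq_of_subset_of_card_le (fun x hx => ?_) hcard.ge
    by_contra hxB
    have hxA : x ∈ A := (Finset.mem_union.1 (h₂ hx)).resolve_right hxB
    have : x ∈ A \ C := hAC ▸ Finset.mem_sdiff.2 ⟨hxA, hxB⟩
    exact (Finset.mem_sdiff.1 this).2 hx
  refine ⟨B, hB, ?_⟩
  rw [← Finset.coe_sdiff, Set.ncard_coe_finset]
  refine le_trans ?_ hkm
  by_contra! hlt
  obtain ⟨A', hA', hcard⟩ := hpair.exists_card_sdiff_eq (n := k + 1) hlt
  exact H α M ℓ w A' B hA' hcard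

theorem exists_nonempty_sum_eq_zero {G : Type*} [AddCommGroup G] [Finite G]
    (x : Fin (Nat.card G) → G) :
    ∃ S : Finset (Fin (Nat.card G)), S.Nonempty ∧ ∑ i ∈ S, x i = 0 := by
  classical
  have := Fintype.ofFinite G
  let s : Fin (Nat.card G + 1) → G := fun k => ∑ i with i.val < k.val, x i
  obtain ⟨j, k, hjk, heq⟩ := Fintype.exists_ne_map_eq_of_card_lt s (by simp)
  wlog hlt : j < k generalizing j k
  · exact this k j hjk.symm heq.symm (lt_of_le_of_ne (not_lt.1 hlt) hjk.symm)
  let T : Fin (Nat.card G + 1) → Finset (Fin (Nat.card G)) := fun k => {i | i.val < k.val}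
  have hsub : T j ⊆ T k := fun i hi => by
    simp only [T, Finset.mem_filter_univ] at hi ⊢
    exact hi.trans hlt
  refine ⟨T k \ T j, ⟨⟨j, by omega⟩, ?_⟩, ?_⟩
  · simpa [T] using hlt
  · rw [Finset.sum_sdiff_eq_sub hsub]
    exact sub_eq_zero.2 heq.symm

theorem lt_davenport {G : Type*} [AddCommGroup G] [Finite G] {k : ℕ} (x : Fin k → G)
    (hx : ∀ S : Finset (Fin k), S.Nonempty → ∑ i ∈ S, x i ≠ 0) : k < davenport G := by
  by_contra! hle
  have hmem : ∀ x : Fin (davenport G) → G, ∃ S : Finset (Fin (davenport G)), S.Nonempty ∧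
      ∑ i ∈ S, x i = 0 :=
    Nat.sInf_mem (s := {n : ℕ | ∀ x : Fin n → G, ∃ S : Finset (Fin n), S.Nonempty ∧
      ∑ i ∈ S, x i = 0}) ⟨_, exists_nonempty_sum_eq_zero⟩
  obtain ⟨S, hS, h0⟩ := hmem fun i => x (Fin.castLE hle i)
  exact hx (S.map (Fin.castLEEmb hle)) (hS.map) (by simpa using h0)

theorem card_le_davenport_of_isAddCyclic {G : Type*} [AddCommGroup G] [Finite G]
    [hG : IsAddCyclic G] : Nat.card G ≤ davenport G := by
  obtain ⟨g, hg⟩ := hG.exists_generator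
  have hord : addOrderOf g = Nat.card G := addOrderOf_eq_card_of_forall_mem_zmultiples hg
  have hpos : 0 < Nat.card G := Nat.card_pos
  have := lt_davenport (k := Nat.card G - 1) (fun _ => g) fun S hS h0 => by
    rw [Finset.sum_const] at h0
    have hle := Nat.le_of_dvd hS.card_pos (addOrderOf_dvd_of_nsmul_eq_zero h0)
    have := S.card_le_univ
    simp only [Fintype.card_fin] at this
    omega
  omega

theorem three_le_davenport_of_addEquiv {G : Type*} [AddCommGroup G] [Finite G]
    (φ : G ≃+ ZMod 2 × ZMod 2) : 3 ≤ davenport G := by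
  refine lt_davenport (k := 2) ![φ.symm (1, 0), φ.symm (0, 1)] fun S hS h0 => ?_
  have h1 : ∑ i ∈ S, (![(1, 0), (0, 1)] : Fin 2 → ZMod 2 × ZMod 2) i = 0 := by
    have := congrArg φ h0
    rw [map_sum, map_zero] at this
    rw [← this]
    refine Finset.sum_congr rfl fun i _ => ?_
    fin_cases i <;> simp
  revert S
  have key : ∀ S : Finset (Fin 2), S.Nonempty →
      ∑ i ∈ S, (![(1, 0), (0, 1)] : Fin 2 → ZMod 2 × ZMod 2) i ≠ 0 := by decide
  exact fun S hS _ h1 => key S hS h1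

/-- A group of order four is cyclic or isomorphic to the Klein four-group. -/
theorem isAddCyclic_or_nonempty_addEquiv {G : Type*} [AddCommGroup G] [Finite G]
    (hG : Nat.card G = 4) : IsAddCyclic G ∨ Nonempty (G ≃+ ZMod 2 × ZMod 2) := by
  by_cases h : ∃ g : G, addOrderOf g = 4
  · obtain ⟨g, hg⟩ := h
    exact Or.inl (isAddCyclic_of_addOrderOf_eq_card g (hg.trans hG.symm))
  · push Not at h
    have : Nontrivial G := Finite.one_lt_card_iff_nontrivial.1 (by omega)
    have : IsAddKleinFour G := ⟨hG, (AddMonoid.exponent_eq_prime_iff Nat.prime_two).2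
      fun g hg => by
        have hdvd : addOrderOf g ∣ 2 ^ 2 := by
          simpa [hG] using addOrderOf_dvd_natCard g
        obtain ⟨k, hk, hgk⟩ := (Nat.dvd_prime_pow Nat.prime_two).1 hdvd
        have h1 : addOrderOf g ≠ 1 := by simpa using hg
        have h4 := h g
        interval_cases k <;> simp_all⟩
    exact Or.inr IsAddKleinFour.nonempty_addEquiv

theorem isStronglyClose_of_addEquiv {G : Type u} {H : Type*} [AddCommGroup G] [AddCommGroup H]
    (φ : G ≃+ H) {k m : ℕ} (hkm : k + 1 ≤ m)
    (hH : ∀ (α : Type v) [DecidableEq α] (M : Matroid α) (ℓ : α → H) (w : α → ℝ)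
      (A B : Finset α), IsRigidPair M ℓ w A B → (A \ B).card ≠ k + 1) :
    IsStronglyClose.{u, v} G (m - 1) :=
  isStronglyClose_of_card_sdiff_ne (Nat.le_sub_of_add_le hkm) fun α _ M _ w A B h =>
    hH α M _ w A B (h.map_label φ)

theorem isStronglyClose_of_isAddCyclic {G : Type u} [AddCommGroup G] [Finite G] [IsAddCyclic G]
    (hG : Nat.card G ≤ 4) : IsStronglyClose.{u, v} G (davenport G - 1) := by
  have hD := card_le_davenport_of_isAddCyclic (G := G)
  have hpos : 0 < Nat.card G := Nat.card_pos
  have φ := (zmodAddCyclicAddEquiv (G := G) inferInstance).symm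
  generalize Nat.card G = n at *
  interval_cases n
  · exact isStronglyClose_of_addEquiv φ hD fun _ _ _ _ _ _ _ h => h.card_sdiff_ne_one
  · exact isStronglyClose_of_addEquiv φ hD fun _ _ _ _ _ _ _ h => h.card_sdiff_ne_two
  · exact isStronglyClose_of_addEquiv φ hD fun _ _ _ _ _ _ _ h => h.card_sdiff_ne_three
  · exact isStronglyClose_of_addEquiv φ hD fun _ _ _ _ _ _ _ h => h.card_sdiff_ne_four

end StronglyClose

end GroupLabeled

theorem mainTheorem7 (G : Type u) [AddCommGroup G] [Finite G] (hG : Nat.card G ≤ 4) :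
    GroupLabeled.IsStronglyClose.{u, v} G (GroupLabeled.davenport G - 1) := by
  have hpos : 0 < Nat.card G := Nat.card_pos
  by_cases hc : IsAddCyclic G
  · exact GroupLabeled.isStronglyClose_of_isAddCyclic hG
  have h4 : Nat.card G = 4 := by
    by_contra h4
    refine hc ?_
    have h : Nat.card G ∣ 2 ∨ Nat.card G ∣ 3 := by
      generalize Nat.card G = n at *
      interval_cases n <;> simp_all
    exact h.elim (isAddCyclic_of_card_dvd_prime (p := 2)) (isAddCyclic_of_card_dvd_prime (p := 3))
  obtain ⟨φ⟩ := (GroupLabeled.isAddCyclic_or_nonempty_addEquiv h4).resolve_left hc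
  exact GroupLabeled.isStronglyClose_of_addEquiv φ
    (GroupLabeled.three_le_davenport_of_addEquiv φ)
    fun _ _ _ _ _ _ _ h => h.card_sdiff_ne_three_of_zmod_two_prod
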